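/- Let $K$ be a centred convex body in $\mathbf{R}^d$, that is, a compact convex set with non-empty interior and $K=-K$, and let $\|x\|_K=\inf\{\lambda>0:\lambda^{-1}x\in K\}$ be the norm with unit ball $K$. A Steiner tree of a finite set $V\subset\mathbf{R}^d$ is a finite tree whose vertices are points of $\mathbf{R}^d$, with vertex set containing $V$, and whose edges are straight-line segments; its vertices not in $V$ are called Steiner points (no lower bound on their degree is required). Its $K$-length is the sum of the lengths of its edges in $\|\cdot\|_K$, and a Steiner tree of $V$ of smallest $K$-length among all Steiner trees of $V$ is called a $K$-Steiner minimal tree. Let $v(K)$ be the maximum possible degree of a vertex, and $s(K)$ the maximum possible degree of a Steiner point, in a $K$-Steiner minimal tree, over all finite sets $V\subset\mathbf{R}^d$. Let $\vartheta(K)$ be the translative covering density of $K$, i.e. the infimum of the (lower) densities of all coverings of $\mathbf{R}^d$ by translates of $K$. Then both maxima $v(K)$ and $s(K)$ exist (they are finite and attained), and \[ s(K)\le v(K)<2^{d+1}\,e\,(d+1)\,\vartheta(K). \] -/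

import Mathlib

open MeasureTheory Set Filter
open scoped ENNReal Pointwise

/-- A centred `d`-dimensional convex body: a compact convex subset of `ℝ^d` with non-empty
interior and with `K = -K`. -/
structure CentredConvexBody (d : ℕ) extends ConvexBody (Fin d → ℝ) where
  interior_nonempty' : (interior carrier).Nonempty
  neg_eq' : -carrier = carrier

/-- The cube `[-s, s]^d`. -/
def cube (d : ℕ) (s : ℝ) : Set (Fin d → ℝ) := Set.Icc (fun _ => -s) (fun _ => s)

/-- The translates `a + K`, `a ∈ A`, cover `ℝ^d`. -/
def IsTranslativeCovering {d : ℕ} (K A : Set (Fin d → ℝ)) : Prop :=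
  ⋃ a ∈ A, (a +ᵥ K) = Set.univ

/-- The (lower) density of the system of translates `a + K`, `a ∈ A`: the lower limit, as
`s → ∞`, of the total volume of the members contained in the cube `[-s, s]^d`, divided by the
volume of that cube. -/
noncomputable def translatesDensity {d : ℕ} (K A : Set (Fin d → ℝ)) : ℝ≥0∞ :=
  liminf (fun s : ℝ =>
    (({a ∈ A | a +ᵥ K ⊆ cube d s}.encard : ℝ≥0∞) * volume K) / volume (cube d s)) atTop

/-- The translative covering density `ϑ(K)`: the infimum of the densities of all coverings of
`ℝ^d` by translates of `K`. -/
noncomputable def coveringDensity {d : ℕ} (K : Set (Fin d → ℝ)) : ℝ :=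
  (⨅ (A : Set (Fin d → ℝ)) (_ : IsTranslativeCovering K A), translatesDensity K A).toReal

/-- A Steiner tree of the finite point set `V`: a finite tree whose vertices are points of `ℝ^d`,
among them all points of `V`; its edges stand for the straight segments between their ends. -/
structure SteinerTree {d : ℕ} (V : Finset (Fin d → ℝ)) where
  verts : Finset (Fin d → ℝ)
  subset_verts : V ⊆ verts
  graph : SimpleGraph verts
  isTree : graph.IsTree

namespace CentredConvexBody

variable {d : ℕ} (K : CentredConvexBody d)

/-- The length `‖x - y‖_K` of the segment between `x` and `y`, in the norm
`‖z‖_K = inf {r > 0 | r⁻¹ z ∈ K}`. -/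
noncomputable def segLength (x y : Fin d → ℝ) : ℝ := gauge K.carrier (x - y)

theorem segLength_comm (x y : Fin d → ℝ) : K.segLength x y = K.segLength y x := by
  have h : ∀ z ∈ K.carrier, -z ∈ K.carrier := fun z hz => by
    rw [← K.neg_eq'] at hz
    exact hz
  unfold segLength
  rw [← gauge_neg h, neg_sub]

open Classical in
/-- The `K`-length of a Steiner tree: the sum of the `K`-lengths of its edges. -/
noncomputable def treeLength {V : Finset (Fin d → ℝ)} (T : SteinerTree V) : ℝ :=
  ∑ e ∈ T.graph.edgeFinset,
    Sym2.lift ⟨fun x y : T.verts => K.segLength x y, fun x y => K.segLength_comm x y⟩ e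

/-- `T` is a `K`-Steiner minimal tree of `V`. -/
def IsSMT {V : Finset (Fin d → ℝ)} (T : SteinerTree V) : Prop :=
  ∀ T' : SteinerTree V, K.treeLength T ≤ K.treeLength T'

open Classical in
/-- The degrees of all vertices of all `K`-Steiner minimal trees. -/
def smtVertexDegrees : Set ℕ :=
  {n | ∃ (V : Finset (Fin d → ℝ)) (T : SteinerTree V) (x : T.verts),
    K.IsSMT T ∧ T.graph.degree x = n}

open Classical in
/-- The degrees of all Steiner points (vertices outside the given set `V`) of all `K`-Steiner
minimal trees. -/
def smtSteinerDegrees : Set ℕ :=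
  {n | ∃ (V : Finset (Fin d → ℝ)) (T : SteinerTree V) (x : T.verts),
    K.IsSMT T ∧ (x : Fin d → ℝ) ∉ V ∧ T.graph.degree x = n}

/-- `v(K)`, the maximum possible degree of a vertex in a `K`-Steiner minimal tree. -/
noncomputable def vNumber : ℕ := sSup K.smtVertexDegrees

/-- `s(K)`, the maximum possible degree of a Steiner point in a `K`-Steiner minimal tree. -/
noncomputable def sNumber : ℕ := sSup K.smtSteinerDegrees

end CentredConvexBody

/-!
The degree of a vertex `x` in a Steiner minimal tree is bounded by comparing the tree with one in
which the star of `x` is rerouted through few hubs. Let `n` be the degree of `x`, and let the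
translates of `K` centred at the `N` points of `F ⊆ (μ + 1)K` cover the dilate `μK`, where
`μ > 1`. After translation and scaling, `x = 0` and the shortest edge at `x` has length `μ`. An edge
from `x` to `y` passes through a point `u` of norm `μ`, which lies within distance `1` of some
`a ∈ F`; joining `y` to `a` instead of `x` saves at least `μ - 1`, and joining the hubs
to `x` costs at most `N (μ + 1)`. The resulting network is connected, so it contains a spanning
tree, and minimality gives `n (μ - 1) ≤ N (μ + 1)` (`IsSMT.sum_neighbors_le`,
`IsSMT.degree_mul_le`).

A covering of small cardinality comes from an averaging argument: in a covering of `ℝ^d` of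
density `ϑ`, a random translate of `μK` is met on average by at most `(μ + 1)^d ϑ` members, because
`a + K` meets `t + μK` exactly when `a ∈ t + (μ + 1)K` (`exists_finset_cover`). Hence
`n ≤ (μ + 1) / (μ - 1) * (μ + 1)^d ϑ(K)`, and `μ = 1 + 1 / (d + 1)` yields the bound; it is strict
because `0 < ϑ(K)` (`coveringDensity_pos`), and it is meaningful because `ϑ(K)` is finite
(`coveringDensity_ne_top`). Both sets of degrees are bounded and contain `0`, so their suprema
are attained.
-/

namespace CentredConvexBody

variable {d : ℕ} (K : CentredConvexBody d)

/-! ### The norm with unit ball `K` -/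

theorem neg_mem {x : Fin d → ℝ} (hx : x ∈ K.carrier) : -x ∈ K.carrier := by
  rw [← K.neg_eq'] at hx
  exact hx

theorem carrier_mem_nhds_zero : K.carrier ∈ nhds (0 : Fin d → ℝ) := by
  rw [← mem_interior_iff_mem_nhds]
  obtain ⟨x, hx⟩ := K.interior_nonempty'
  have hx' : -x ∈ interior K.carrier := by
    rw [← K.neg_eq']
    have h := (Homeomorph.neg (Fin d → ℝ)).preimage_interior K.carrier
    refine (Set.ext_iff.1 h (-x)).1 ?_
    simpa using hx
  have h := K.convex'.interior hx hx' (a := 1 / 2) (b := 1 / 2) (by norm_num) (by norm_num)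
    (by norm_num)
  simpa using h

theorem absorbent : Absorbent ℝ K.carrier := absorbent_nhds_zero K.carrier_mem_nhds_zero

theorem gauge_pos_of_ne_zero {x : Fin d → ℝ} (hx : x ≠ 0) : 0 < gauge K.carrier x :=
  (gauge_pos K.absorbent
    (NormedSpace.isVonNBounded_of_isBounded ℝ K.isCompact'.isBounded)).2 hx

theorem gauge_le_one_iff {x : Fin d → ℝ} : gauge K.carrier x ≤ 1 ↔ x ∈ K.carrier := by
  rw [gauge_le_one_iff_mem_closure K.convex' K.carrier_mem_nhds_zero,
    K.isCompact'.isClosed.closure_eq]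

theorem gauge_smul_nonneg {r : ℝ} (hr : 0 ≤ r) (x : Fin d → ℝ) :
    gauge K.carrier (r • x) = r * gauge K.carrier x := by
  rw [gauge_smul_of_nonneg hr, smul_eq_mul]

theorem gauge_le_iff_mem_smul {r : ℝ} (hr : 0 < r) {x : Fin d → ℝ} :
    gauge K.carrier x ≤ r ↔ x ∈ r • K.carrier := by
  rw [mem_smul_set_iff_inv_smul_mem₀ hr.ne', ← K.gauge_le_one_iff,
    K.gauge_smul_nonneg (inv_nonneg.2 hr.le), inv_mul_le_iff₀ hr, mul_one]

theorem segLength_triangle (x y z : Fin d → ℝ) :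
    K.segLength x z ≤ K.segLength x y + K.segLength y z := by
  unfold segLength
  rw [← sub_add_sub_cancel x y z]
  exact gauge_add_le K.convex' K.absorbent _ _

theorem segLength_nonneg (x y : Fin d → ℝ) : 0 ≤ K.segLength x y := gauge_nonneg _

/-! ### Replacing the star of a vertex in a Steiner minimal tree -/

/-- The `K`-length of the segment between the two members of an unordered pair of points. -/
noncomputable def edgeLength (e : Sym2 (Fin d → ℝ)) : ℝ :=
  Sym2.lift ⟨K.segLength, K.segLength_comm⟩ e

theorem edgeLength_nonneg (e : Sym2 (Fin d → ℝ)) : 0 ≤ K.edgeLength e := by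
  induction e with
  | _ x y => exact K.segLength_nonneg x y

open Classical in
theorem treeLength_eq_sum_image {V : Finset (Fin d → ℝ)} (T : SteinerTree V) :
    K.treeLength T =
      ∑ e ∈ T.graph.edgeFinset.image (Sym2.map Subtype.val), K.edgeLength e := by
  rw [Finset.sum_image (Sym2.map.injective Subtype.val_injective).injOn]
  refine Finset.sum_congr rfl fun e _ => ?_
  induction e with
  | _ x y => rfl

/-- A finite set of segments connecting a finite set `W ⊇ V` of points is at least as long as
some Steiner tree of `V`, namely a spanning tree. -/
theorem exists_steinerTree_treeLength_le {V W : Finset (Fin d → ℝ)} (hVW : V ⊆ W)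
    (S : Finset (Sym2 (Fin d → ℝ)))
    (hS : ((SimpleGraph.fromEdgeSet (S : Set (Sym2 (Fin d → ℝ)))).comap
      (Subtype.val : W → Fin d → ℝ)).Connected) :
    ∃ T : SteinerTree V, K.treeLength T ≤ ∑ e ∈ S, K.edgeLength e := by
  classical
  obtain ⟨G, hG, hGt⟩ := hS.exists_isTree_le
  refine ⟨⟨W, hVW, G, hGt⟩, ?_⟩
  rw [treeLength_eq_sum_image]
  refine Finset.sum_le_sum_of_subset_of_nonneg ?_ fun e _ _ => K.edgeLength_nonneg e
  intro e he
  obtain ⟨e', he', rfl⟩ := Finset.mem_image.1 he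
  induction e' with
  | _ x y =>
    have h := hG (SimpleGraph.mem_edgeFinset.1 he')
    simp only [SimpleGraph.comap_adj, SimpleGraph.fromEdgeSet_adj] at h
    exact h.1

open Classical in
/-- In a Steiner minimal tree, the edges at a vertex `x` are together no longer than any network
that joins `x` to hubs `t ∈ F` and each neighbour `y` of `x` to a hub `c y ∈ F`. -/
theorem IsSMT.sum_neighbors_le {V : Finset (Fin d → ℝ)} {T : SteinerTree V} (hT : K.IsSMT T)
    (x : T.verts) (F : Finset (Fin d → ℝ)) (c : T.verts → Fin d → ℝ)
    (hc : ∀ y ∈ T.graph.neighborFinset x, c y ∈ F) :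
    ∑ y ∈ T.graph.neighborFinset x, K.segLength x y ≤
      ∑ t ∈ F, K.segLength x t + ∑ y ∈ T.graph.neighborFinset x, K.segLength (c y) y := by
  set N := T.graph.neighborFinset x with hN
  set R := {e ∈ T.graph.edgeFinset | x ∉ e} with hR
  set W := T.verts ∪ F with hW
  set S₁ := R.image (Sym2.map Subtype.val) with hS₁
  set S₂ := F.image fun t => s((x : Fin d → ℝ), t) with hS₂
  set S₃ := N.image fun y => s(c y, (y : Fin d → ℝ)) with hS₃
  set H := (SimpleGraph.fromEdgeSet ((S₁ ∪ (S₂ ∪ S₃) : Finset _) : Set (Sym2 (Fin d → ℝ)))).comap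
      (Subtype.val : W → Fin d → ℝ) with hH
  -- `S₁` holds the edges away from `x`, `S₂` joins `x` to the hubs, `S₃` the neighbours to theirs;
  -- some of these pairs may coincide or be loops, which only makes the network shorter.
  have reach : ∀ a b : W, s((a : Fin d → ℝ), (b : Fin d → ℝ)) ∈ S₁ ∪ (S₂ ∪ S₃) →
      H.Reachable a b := by
    intro a b hab
    by_cases h : a = b
    · rw [h]
    · refine SimpleGraph.Adj.reachable ?_
      simp only [hH, SimpleGraph.comap_adj, SimpleGraph.fromEdgeSet_adj]
      exact ⟨hab, fun h' => h (Subtype.ext h')⟩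
  let ι : T.verts → W := fun y => ⟨y, Finset.mem_union_left _ y.2⟩
  have hub : ∀ t (ht : t ∈ F), H.Reachable (ι x) ⟨t, Finset.mem_union_right _ ht⟩ := by
    intro t ht
    refine reach _ _ (Finset.mem_union_right _ (Finset.mem_union_left _ ?_))
    exact Finset.mem_image_of_mem _ ht
  have nbr : ∀ y, T.graph.Adj x y → H.Reachable (ι x) (ι y) := by
    intro y hy
    have hy' : y ∈ N := by simpa [hN] using hy
    refine (hub (c y) (hc y hy')).trans (reach _ _ ?_)
    refine Finset.mem_union_right _ (Finset.mem_union_right _ ?_)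
    exact Finset.mem_image_of_mem (fun y : T.verts => s(c y, (y : Fin d → ℝ))) hy'
  have old : ∀ a b, T.graph.Adj a b → H.Reachable (ι a) (ι b) := by
    intro a b hab
    by_cases ha : x = a
    · subst ha; exact nbr b hab
    by_cases hb : x = b
    · subst hb; exact (nbr a hab.symm).symm
    refine reach _ _ (Finset.mem_union_left _ ?_)
    refine Finset.mem_image.2 ⟨s(a, b), ?_, rfl⟩
    simp [hR, hab, ha, hb]
  have conn : H.Connected := by
    rw [SimpleGraph.connected_iff_exists_forall_reachable]
    refine ⟨ι x, ?_⟩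
    rintro ⟨w, hw⟩
    rcases Finset.mem_union.1 hw with h | h
    · obtain ⟨p⟩ := T.isTree.1.preconnected x ⟨w, h⟩
      have : ∀ (a b : T.verts), T.graph.Walk a b → H.Reachable (ι a) (ι b) := by
        intro a b p
        induction p with
        | nil => rfl
        | cons h _ ih => exact (old _ _ h).trans ih
      exact this _ _ p
    · exact hub w h
  obtain ⟨T', hT'⟩ := K.exists_steinerTree_treeLength_le
    (T.subset_verts.trans Finset.subset_union_left) _ conn
  have hlen : K.treeLength T =
      ∑ e ∈ S₁, K.edgeLength e + ∑ y ∈ N, K.segLength x y := by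
    rw [treeLength_eq_sum_image,
      Finset.sum_image (Sym2.map.injective Subtype.val_injective).injOn,
      ← Finset.sum_filter_not_add_sum_filter _ (fun e => x ∈ e), hS₁,
      Finset.sum_image (Sym2.map.injective Subtype.val_injective).injOn]
    congr 1
    have : {e ∈ T.graph.edgeFinset | x ∈ e} = N.image fun y => s(x, y) := by
      ext e
      induction e with
      | _ a b =>
        simp only [Finset.mem_filter, SimpleGraph.mem_edgeFinset, SimpleGraph.mem_edgeSet,
          Sym2.mem_iff, Finset.mem_image, hN, SimpleGraph.mem_neighborFinset, Sym2.eq_iff]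
        constructor
        · rintro ⟨h, rfl | rfl⟩
          · exact ⟨b, h, Or.inl ⟨rfl, rfl⟩⟩
          · exact ⟨a, h.symm, Or.inr ⟨rfl, rfl⟩⟩
        · rintro ⟨y, h, ⟨rfl, rfl⟩ | ⟨rfl, rfl⟩⟩
          · exact ⟨h, Or.inl rfl⟩
          · exact ⟨h.symm, Or.inr rfl⟩
    rw [this, Finset.sum_image]
    · rfl
    · intro y _ z _ h
      exact Sym2.congr_right.1 h
  have union_le : ∀ A B : Finset (Sym2 (Fin d → ℝ)), ∑ e ∈ A ∪ B, K.edgeLength e ≤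
      ∑ e ∈ A, K.edgeLength e + ∑ e ∈ B, K.edgeLength e := by
    intro A B
    rw [← Finset.sum_union_inter]
    exact le_add_of_nonneg_right (Finset.sum_nonneg fun e _ => K.edgeLength_nonneg e)
  have h₂ : ∑ e ∈ S₂, K.edgeLength e ≤ ∑ t ∈ F, K.segLength x t :=
    Finset.sum_image_le_of_nonneg fun e _ => K.edgeLength_nonneg e
  have h₃ : ∑ e ∈ S₃, K.edgeLength e ≤ ∑ y ∈ N, K.segLength (c y) y :=
    Finset.sum_image_le_of_nonneg fun e _ => K.edgeLength_nonneg e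
  linarith [hT T', union_le S₁ (S₂ ∪ S₃), union_le S₂ S₃]

open Classical in
/-- If `n` is the degree of a vertex of a Steiner minimal tree and the translates of `K` centred
at points of `F ⊆ (μ + 1)K` cover `μK`, then `n (μ - 1) ≤ |F| (μ + 1)`. At the scale where the
shortest edge has length `μ`, each of the `n` edges is shortened by at least `μ - 1` when it is
redirected to a suitable hub in `F`, and joining a hub to the vertex costs at most `μ + 1`. -/
theorem IsSMT.degree_mul_le {V : Finset (Fin d → ℝ)} {T : SteinerTree V} (hT : K.IsSMT T)
    (x : T.verts) {μ : ℝ} (hμ : 0 < μ) (F : Finset (Fin d → ℝ))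
    (hF : ∀ a ∈ F, gauge K.carrier a ≤ μ + 1)
    (hcov : ∀ y, gauge K.carrier y ≤ μ → ∃ a ∈ F, gauge K.carrier (y - a) ≤ 1) :
    (T.graph.degree x : ℝ) * (μ - 1) ≤ F.card * (μ + 1) := by
  have hF0 : (0 : ℝ) ≤ F.card * (μ + 1) := by positivity
  set N := T.graph.neighborFinset x with hN
  rcases N.eq_empty_or_nonempty with h0 | hne
  · rw [← SimpleGraph.card_neighborFinset_eq_degree, ← hN, h0]
    simpa using hF0
  have hpos : ∀ y ∈ N, 0 < K.segLength y x := by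
    intro y hy
    refine K.gauge_pos_of_ne_zero (sub_ne_zero.2 fun h => ?_)
    have : T.graph.Adj x y := by simpa [hN] using hy
    exact this.ne (Subtype.ext h.symm)
  -- Hubs are placed at the scale `δ / μ`, where `δ` is the length of a shortest edge at `x`.
  obtain ⟨y₀, hy₀, hmin⟩ := N.exists_min_image (fun y => K.segLength y x) hne
  set δ := K.segLength y₀ x with hδ
  have hδ0 : 0 < δ := hpos y₀ hy₀
  set r := δ / μ with hr
  have hr0 : 0 < r := div_pos hδ0 hμ
  have hrμ : r * μ = δ := div_mul_cancel₀ _ hμ.ne'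
  have key : ∀ y : T.verts, ∃ a : Fin d → ℝ, y ∈ N → a ∈ F ∧
      K.segLength (x + r • a) y ≤ r + (K.segLength x y - δ) := by
    intro y
    by_cases hy : y ∈ N
    swap
    · exact ⟨0, fun h => absurd h hy⟩
    set L := K.segLength y x with hL
    have hL0 : 0 < L := hpos y hy
    have hδL : δ ≤ L := hmin y hy
    -- `u` is the direction of the edge from `x` to `y`, normalised to length `μ`.
    set u : Fin d → ℝ := (μ / L) • ((y : Fin d → ℝ) - x) with hu
    have hLg : gauge K.carrier ((y : Fin d → ℝ) - x) = L := rfl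
    have hug : gauge K.carrier u ≤ μ := by
      rw [hu, K.gauge_smul_nonneg (by positivity), hLg, div_mul_cancel₀ _ hL0.ne']
    obtain ⟨a, haF, ha⟩ := hcov u hug
    refine ⟨a, fun _ => ⟨haF, ?_⟩⟩
    have h1 : K.segLength (x + r • a) (x + r • u) ≤ r := by
      rw [K.segLength_comm]
      have : (x : Fin d → ℝ) + r • u - (x + r • a) = r • (u - a) := by
        rw [smul_sub]; abel
      rw [segLength, this, K.gauge_smul_nonneg hr0.le]
      exact mul_le_of_le_one_right hr0.le ha
    have h2 : K.segLength (x + r • u) y = L - δ := by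
      rw [K.segLength_comm]
      have : (y : Fin d → ℝ) - (x + r • u) = (1 - δ / L) • ((y : Fin d → ℝ) - x) := by
        have : r * (μ / L) = δ / L := by rw [← mul_div_assoc, hrμ]
        rw [hu, smul_smul, this, sub_smul, one_smul]; abel
      rw [segLength, this, K.gauge_smul_nonneg (sub_nonneg.2 ((div_le_one hL0).2 hδL)), hLg]
      field_simp
    rw [K.segLength_comm x y]
    linarith [K.segLength_triangle (x + r • a) (x + r • u) y]
  choose c hc using key
  have main := hT.sum_neighbors_le K x (F.image fun a => (x : Fin d → ℝ) + r • a)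
    (fun y => x + r • c y) fun y hy => Finset.mem_image_of_mem _ (hc y hy).1
  rw [← hN] at main
  have hA : ∑ t ∈ F.image (fun a => (x : Fin d → ℝ) + r • a), K.segLength x t ≤
      F.card * (r * (μ + 1)) := by
    refine (Finset.sum_image_le_of_nonneg fun t _ => K.segLength_nonneg _ _).trans ?_
    rw [← nsmul_eq_mul]
    refine Finset.sum_le_card_nsmul _ _ _ fun a ha => ?_
    rw [K.segLength_comm, segLength, add_sub_cancel_left, K.gauge_smul_nonneg hr0.le]
    exact mul_le_mul_of_nonneg_left (hF a ha) hr0.le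
  have hB : ∑ y ∈ N, K.segLength (x + r • c y) y ≤
      ∑ y ∈ N, K.segLength x y + N.card * (r - δ) := by
    rw [← nsmul_eq_mul, ← Finset.sum_const, ← Finset.sum_add_distrib]
    refine Finset.sum_le_sum fun y hy => ?_
    linarith [(hc y hy).2]
  rw [← SimpleGraph.card_neighborFinset_eq_degree, ← hN]
  have : r * ((N.card : ℝ) * (μ - 1)) ≤ r * (F.card * (μ + 1)) := by
    rw [← hrμ] at hB
    linarith
  exact le_of_mul_le_mul_left this hr0

end CentredConvexBody

/-! ### The cubes `[-s, s]^d` -/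

theorem volume_cube (d : ℕ) {s : ℝ} (hs : 0 ≤ s) :
    volume (cube d s) = ENNReal.ofReal ((2 * s) ^ d) := by
  rw [cube, Real.volume_Icc_pi]
  simp only [sub_neg_eq_add, Finset.prod_const, Finset.card_univ, Fintype.card_fin]
  rw [← two_mul, ENNReal.ofReal_pow (by positivity)]

theorem mem_cube {d : ℕ} {s : ℝ} {x : Fin d → ℝ} : x ∈ cube d s ↔ ∀ i, |x i| ≤ s := by
  simp only [cube, Set.mem_Icc, Pi.le_def, abs_le, forall_and]

namespace CentredConvexBody

variable {d : ℕ} (K : CentredConvexBody d)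

/-! ### Covering a dilate of `K` by translates of `K` -/

theorem exists_gauge_le_abs_le : ∃ R : ℝ, 0 < R ∧ ∀ x i, |x i| ≤ R * gauge K.carrier x := by
  obtain ⟨R, hR, hKR⟩ := K.isCompact'.isBounded.subset_closedBall_lt 0 0
  refine ⟨R, hR, fun x i => ?_⟩
  have h := le_gauge_of_subset_closedBall K.absorbent hR.le hKR (x := x)
  rw [div_le_iff₀ hR] at h
  rw [mul_comm]
  exact (norm_le_pi_norm x i).trans h

theorem volume_toReal_pos : 0 < (volume K.carrier).toReal :=
  ENNReal.toReal_pos (Measure.measure_pos_of_mem_nhds volume K.carrier_mem_nhds_zero).ne'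
    K.isCompact'.measure_lt_top.ne

theorem volume_gauge_sub_le (b : Fin d → ℝ) {r : ℝ} (hr : 0 < r) :
    volume {t | gauge K.carrier (b - t) ≤ r} = ENNReal.ofReal (r ^ d) * volume K.carrier := by
  have : {t | gauge K.carrier (b - t) ≤ r} = b +ᵥ (r • K.carrier) := by
    ext t
    rw [mem_vadd_set_iff_neg_vadd_mem, ← K.gauge_le_iff_mem_smul hr, Set.mem_ofPred_eq,
      ← gauge_neg (fun x => K.neg_mem), neg_sub, vadd_eq_add, neg_add_eq_sub]
  rw [this, measure_vadd, Measure.addHaar_smul, Module.finrank_fin_fun, abs_of_pos (by positivity)]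

/-- Averaging over the position of `t` in the cube `C`: if every `t ∈ C` has at least `m` points
of the finite set `B` at distance at most `r`, then `m vol C ≤ |B| r^d vol K`. -/
theorem mul_volume_le_of_forall_card_le (B : Finset (Fin d → ℝ)) {C : Set (Fin d → ℝ)}
    {r : ℝ} (hr : 0 < r) (m : ℝ≥0∞)
    (h : ∀ t ∈ C, m ≤ (B.filter fun b => gauge K.carrier (b - t) ≤ r).card) :
    m * volume C ≤ B.card * (ENNReal.ofReal (r ^ d) * volume K.carrier) := by
  have hmeas : ∀ b, MeasurableSet {t | gauge K.carrier (b - t) ≤ r} := fun b =>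
    (isClosed_le ((continuous_gauge K.convex' K.carrier_mem_nhds_zero).comp
      (continuous_const.sub continuous_id)) continuous_const).measurableSet
  calc m * volume C = ∫⁻ _ in C, m := by rw [setLIntegral_const]
    _ ≤ ∫⁻ t in C, ∑ b ∈ B, {t | gauge K.carrier (b - t) ≤ r}.indicator 1 t := by
        refine setLIntegral_mono (Finset.measurable_sum _ fun b _ =>
          measurable_one.indicator (hmeas b)) fun t ht => ?_
        refine (h t ht).trans (le_of_eq ?_)
        simp [Set.indicator_apply, Finset.sum_boole]
    _ ≤ ∫⁻ t, ∑ b ∈ B, {t | gauge K.carrier (b - t) ≤ r}.indicator 1 t :=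
        setLIntegral_le_lintegral _ _
    _ = ∑ b ∈ B, volume {t | gauge K.carrier (b - t) ≤ r} := by
        rw [lintegral_finsetSum _ fun b _ => measurable_one.indicator (hmeas b)]
        exact Finset.sum_congr rfl fun b _ => lintegral_indicator_one (hmeas b)
    _ = B.card * (ENNReal.ofReal (r ^ d) * volume K.carrier) := by
        simp_rw [K.volume_gauge_sub_le _ hr, Finset.sum_const, nsmul_eq_mul]

/-- Among all positions of a covering of density less than `c` relative to `μK`, some position
has at most `(μ + 1)^d c` centres in `(μ + 1)K`; the translates at these centres
cover `μK`. -/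
theorem exists_finset_cover {A : Set (Fin d → ℝ)} (hA : IsTranslativeCovering K.carrier A)
    {c μ : ℝ} (hμ : 0 < μ) (hc : translatesDensity K.carrier A < ENNReal.ofReal c) :
    ∃ F : Finset (Fin d → ℝ), (F.card : ℝ) ≤ (μ + 1) ^ d * c ∧
      (∀ a ∈ F, gauge K.carrier a ≤ μ + 1) ∧
      ∀ y, gauge K.carrier y ≤ μ → ∃ a ∈ F, gauge K.carrier (y - a) ≤ 1 := by
  classical
  have hc0 : 0 < c := ENNReal.ofReal_pos.1 (pos_of_gt hc)
  obtain ⟨c', hc'1, hc'2⟩ : ∃ c' : ℝ, translatesDensity K.carrier A < ENNReal.ofReal c' ∧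
      c' < c := by
    obtain ⟨e, he1, he2⟩ := exists_between hc
    refine ⟨e.toReal, by rwa [ENNReal.ofReal_toReal he2.ne_top], ?_⟩
    exact (ENNReal.lt_ofReal_iff_toReal_lt he2.ne_top).1 he2
  have hc'0 : 0 < c' := ENNReal.ofReal_pos.1 (pos_of_gt hc'1)
  obtain ⟨R, hR, hRb⟩ := K.exists_gauge_le_abs_le
  set ρ := R * (μ + 2) with hρ
  -- Shrinking a large cube by the fixed amount `ρ` hardly changes its volume.
  have hlim : Tendsto (fun s : ℝ => c' * (2 * s) ^ d / (2 * (s - ρ)) ^ d) atTop (nhds c') := by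
    have h1 : Tendsto (fun s : ℝ => c' * (1 + ρ / (s - ρ)) ^ d) atTop
        (nhds (c' * (1 + 0) ^ d)) := by
      refine tendsto_const_nhds.mul ((tendsto_const_nhds.add ?_).pow d)
      exact Tendsto.div_atTop tendsto_const_nhds
        (tendsto_atTop_add_const_right _ (-ρ) tendsto_id)
    rw [add_zero, one_pow, mul_one] at h1
    refine h1.congr' ?_
    filter_upwards [eventually_gt_atTop ρ] with s hs
    have : s - ρ ≠ 0 := (sub_pos.2 hs).ne'
    rw [mul_div_assoc c', ← div_pow]
    congr 2
    field_simp
    ring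
  obtain ⟨s, hs1, hs2, hs3⟩ := ((frequently_lt_of_liminf_lt (by isBoundedDefault)
    hc'1).and_eventually ((hlim.eventually (gt_mem_nhds hc'2)).and
      (eventually_gt_atTop ρ))).exists
  have hρ0 : 0 < ρ := by positivity
  have hs0 : 0 < s := hρ0.trans hs3
  have hsρ : 0 < s - ρ := sub_pos.2 hs3
  have hkpos := K.volume_toReal_pos
  have hkE : volume K.carrier = ENNReal.ofReal (volume K.carrier).toReal :=
    (ENNReal.ofReal_toReal K.isCompact'.measure_lt_top.ne).symm
  set k := (volume K.carrier).toReal with hk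
  have hvs : (0 : ℝ) < (2 * s) ^ d := by positivity
  have hcount : ({a ∈ A | a +ᵥ K.carrier ⊆ cube d s}.encard : ℝ≥0∞) * volume K.carrier <
      ENNReal.ofReal (c' * (2 * s) ^ d) := by
    rw [ENNReal.ofReal_mul hc'0.le, ← volume_cube d hs0.le]
    refine (ENNReal.div_lt_iff (Or.inl ?_) (Or.inl ?_)).1 hs1
    · rw [volume_cube d hs0.le]; exact (ENNReal.ofReal_pos.2 hvs).ne'
    · rw [volume_cube d hs0.le]; exact ENNReal.ofReal_ne_top
  have hfin : {a ∈ A | a +ᵥ K.carrier ⊆ cube d s}.Finite := by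
    by_contra hinf
    have hinf' : {a ∈ A | a +ᵥ K.carrier ⊆ cube d s}.encard = ⊤ :=
      Set.Infinite.encard_eq hinf
    rw [hinf', ENat.toENNReal_top, ENNReal.top_mul] at hcount
    · exact not_top_lt hcount
    · rw [hkE]; exact (ENNReal.ofReal_pos.2 hkpos).ne'
  set B := hfin.toFinset with hB
  have hBcard : (B.card : ℝ) * k < c' * (2 * s) ^ d := by
    rw [hfin.encard_eq_coe_toFinset_card, ← hB, hkE] at hcount
    rw [ENat.toENNReal_coe, ← ENNReal.ofReal_natCast,
      ← ENNReal.ofReal_mul (Nat.cast_nonneg _)] at hcount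
    exact (ENNReal.ofReal_lt_ofReal_iff (by positivity)).1 hcount
  have hmemB : ∀ t ∈ cube d (s - ρ), ∀ a ∈ A, gauge K.carrier (a - t) ≤ μ + 1 → a ∈ B := by
    intro t ht a ha hat
    rw [hB, Set.Finite.mem_toFinset]
    refine ⟨ha, ?_⟩
    rintro _ ⟨y, hy, rfl⟩
    rw [mem_cube] at ht ⊢
    intro i
    have h1 := ht i
    have h2 := (hRb (a - t) i).trans (mul_le_mul_of_nonneg_left hat hR.le)
    have h3 := (hRb y i).trans (mul_le_mul_of_nonneg_left (gauge_le_one_of_mem hy) hR.le)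
    have h4 : (a +ᵥ y) i = t i + (a - t) i + y i := by simp
    rw [show (fun x => a +ᵥ x) y = a +ᵥ y from rfl, h4]
    have h5 : s = (s - ρ) + R * (μ + 1) + R * 1 := by rw [hρ]; ring
    exact (abs_add_three _ _ _).trans (h5 ▸ add_le_add (add_le_add h1 h2) h3)
  obtain ⟨t, ht, htc⟩ : ∃ t ∈ cube d (s - ρ),
      ((B.filter fun b => gauge K.carrier (b - t) ≤ μ + 1).card : ℝ) ≤ (μ + 1) ^ d * c := by
    by_contra! hcon
    have h := K.mul_volume_le_of_forall_card_le B (C := cube d (s - ρ)) (r := μ + 1)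
      (by positivity) (ENNReal.ofReal ((μ + 1) ^ d * c)) fun t ht => by
        rw [← ENNReal.ofReal_natCast]
        exact ENNReal.ofReal_le_ofReal (hcon t ht).le
    rw [volume_cube d hsρ.le, hkE, ← ENNReal.ofReal_mul (by positivity),
      ← ENNReal.ofReal_mul (by positivity), ← ENNReal.ofReal_natCast,
      ← ENNReal.ofReal_mul (Nat.cast_nonneg _), ENNReal.ofReal_le_ofReal_iff
        (mul_nonneg (Nat.cast_nonneg _) (by positivity))] at h
    rw [div_lt_iff₀ (by positivity)] at hs2
    have hμd : (0 : ℝ) < (μ + 1) ^ d := by positivity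
    nlinarith [mul_lt_mul_of_pos_left (hBcard.trans hs2) hμd]
  refine ⟨(B.filter fun b => gauge K.carrier (b - t) ≤ μ + 1).image (· - t), ?_, ?_, ?_⟩
  · exact le_trans (Nat.cast_le.2 Finset.card_image_le) htc
  · intro a ha
    obtain ⟨b, hb, rfl⟩ := Finset.mem_image.1 ha
    exact (Finset.mem_filter.1 hb).2
  · intro y hy
    have hyt : t + y ∈ ⋃ a ∈ A, (a +ᵥ K.carrier) := by rw [hA]; trivial
    simp only [Set.mem_iUnion] at hyt
    obtain ⟨a, ha, z, hz, haz⟩ := hyt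
    have haz' : a + z = t + y := haz
    have hat : a - t = y + -z := by
      rw [← sub_eq_add_neg, sub_eq_sub_iff_add_eq_add, haz', add_comm]
    have hg : gauge K.carrier (a - t) ≤ μ + 1 := by
      rw [hat]
      exact (gauge_add_le K.convex' K.absorbent _ _).trans
        (add_le_add hy (gauge_le_one_of_mem (K.neg_mem hz)))
    refine ⟨a - t, Finset.mem_image_of_mem _ (Finset.mem_filter.2 ⟨hmemB t ht a ha hg, hg⟩), ?_⟩
    have : y - (a - t) = z := by rw [hat]; abel
    rw [this]
    exact gauge_le_one_of_mem hz

/-- The covering by a cubic lattice of mesh so small that a cell lies in `K` has finite density. -/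
theorem coveringDensity_ne_top :
    (⨅ (A : Set (Fin d → ℝ)) (_ : IsTranslativeCovering K.carrier A),
      translatesDensity K.carrier A) ≠ ⊤ := by
  classical
  obtain ⟨ε, hε, hεK⟩ := Metric.mem_nhds_iff.1 K.carrier_mem_nhds_zero
  set η := ε / 2 with hη
  have hη0 : 0 < η := half_pos hε
  set A : Set (Fin d → ℝ) := Set.range fun z : Fin d → ℤ => fun i => η * z i with hA
  have hcov : IsTranslativeCovering K.carrier A := by
    refine Set.eq_univ_of_forall fun x => ?_
    simp only [Set.mem_iUnion]
    refine ⟨_, ⟨fun i => ⌊x i / η⌋, rfl⟩, ?_⟩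
    rw [mem_vadd_set_iff_neg_vadd_mem]
    refine hεK ?_
    rw [mem_ball_zero_iff]
    refine lt_of_le_of_lt ((pi_norm_le_iff_of_nonneg hη0.le).2 fun i => ?_) (half_lt_self hε)
    have h1 := Int.floor_le (x i / η)
    have h2 := Int.lt_floor_add_one (x i / η)
    rw [le_div_iff₀ hη0] at h1
    rw [div_lt_iff₀ hη0] at h2
    rw [Real.norm_eq_abs, abs_le]
    simp only [vadd_eq_add, Pi.add_apply, Pi.neg_apply]
    constructor <;> nlinarith
  refine ne_top_of_le_ne_top (b := ENNReal.ofReal ((3 / (2 * η)) ^ d) * volume K.carrier)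
    (ENNReal.mul_ne_top ENNReal.ofReal_ne_top K.isCompact'.measure_lt_top.ne) ?_
  -- For `s ≥ η` at most `(2 s / η + 1)^d ≤ (3 s / η)^d` lattice points lie in `[-s, s]^d`.
  refine (iInf₂_le A hcov).trans (liminf_le_of_frequently_le' (Eventually.frequently ?_))
  filter_upwards [eventually_ge_atTop η] with s hs
  have hs0 : 0 < s := hη0.trans_le hs
  set n : ℤ := ⌊s / η⌋ with hn
  have hn1 : (1 : ℝ) ≤ s / η := (one_le_div hη0).2 hs
  have hnle : (n : ℝ) ≤ s / η := Int.floor_le _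
  have hn0 : 0 ≤ n := Int.floor_nonneg.2 (by positivity)
  have hcard : ({a ∈ A | a +ᵥ K.carrier ⊆ cube d s}.encard : ℝ≥0∞) ≤
      ENNReal.ofReal ((3 * (s / η)) ^ d) := by
    have hsub : {a ∈ A | a +ᵥ K.carrier ⊆ cube d s} ⊆
        (((Fintype.piFinset fun _ : Fin d => Finset.Icc (-n) n).image
          fun z : Fin d → ℤ => fun i => η * (z i : ℝ) : Finset (Fin d → ℝ)) :
            Set (Fin d → ℝ)) := by
      rintro _ ⟨⟨z, rfl⟩, hz⟩
      rw [Finset.mem_coe]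
      refine Finset.mem_image_of_mem _ (Fintype.mem_piFinset.2 fun i => ?_)
      have h0 : (fun i => η * (z i : ℝ)) ∈ cube d s := by
        refine hz ⟨0, mem_of_mem_nhds K.carrier_mem_nhds_zero, ?_⟩
        simp
      have h1 := mem_cube.1 h0 i
      rw [abs_le] at h1
      rw [Finset.mem_Icc, neg_le]
      constructor
      · refine Int.le_floor.2 ?_
        rw [le_div_iff₀ hη0]; push_cast; nlinarith [h1.1]
      · refine Int.le_floor.2 ?_
        rw [le_div_iff₀ hη0]; nlinarith [h1.2]
    refine (ENat.toENNReal_le.2 (Set.encard_le_encard hsub)).trans ?_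
    rw [Set.encard_coe_eq_coe_finsetCard, ENat.toENNReal_coe, ← ENNReal.ofReal_natCast]
    refine ENNReal.ofReal_le_ofReal ((Nat.cast_le.2 Finset.card_image_le).trans ?_)
    rw [Fintype.card_piFinset]
    simp only [Int.card_Icc, Finset.prod_const, Finset.card_univ, Fintype.card_fin]
    push_cast
    refine pow_le_pow_left₀ (Nat.cast_nonneg _) ?_ d
    have : (((n + 1 - -n).toNat : ℤ) : ℝ) = 2 * n + 1 := by
      rw [Int.toNat_of_nonneg (by omega)]; push_cast; ring
    rw [Int.cast_natCast] at this
    rw [this]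
    linarith
  refine ENNReal.div_le_of_le_mul ?_
  rw [volume_cube d hs0.le, mul_right_comm, ← ENNReal.ofReal_mul (by positivity), ← mul_pow]
  refine mul_le_mul_left (hcard.trans (le_of_eq ?_)) _
  congr 2
  field_simp

/-- The covering number of `μK` by translates of `K` is at most `(μ + 1)^d ϑ(K)`, up to an
arbitrarily small error in `ϑ(K)`. -/
theorem exists_finset_cover_of_coveringDensity_lt {c μ : ℝ} (hμ : 0 < μ)
    (hc : coveringDensity K.carrier < c) :
    ∃ F : Finset (Fin d → ℝ), (F.card : ℝ) ≤ (μ + 1) ^ d * c ∧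
      (∀ a ∈ F, gauge K.carrier a ≤ μ + 1) ∧
      ∀ y, gauge K.carrier y ≤ μ → ∃ a ∈ F, gauge K.carrier (y - a) ≤ 1 := by
  rw [coveringDensity, ← ENNReal.lt_ofReal_iff_toReal_lt K.coveringDensity_ne_top] at hc
  simp only [iInf_lt_iff] at hc
  obtain ⟨A, hA, h⟩ := hc
  exact K.exists_finset_cover hA hμ h

theorem coveringDensity_pos : 0 < coveringDensity K.carrier := by
  have h : (1 : ℝ) ≤ (1 + 1) ^ d * coveringDensity K.carrier := by
    rw [← div_le_iff₀' (by positivity)]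
    refine le_of_forall_gt_imp_ge_of_dense fun c hc => ?_
    obtain ⟨F, hF, -, hcov⟩ := K.exists_finset_cover_of_coveringDensity_lt one_pos hc
    obtain ⟨a, ha, -⟩ := hcov 0 (by simp)
    rw [div_le_iff₀' (by positivity)]
    refine le_trans ?_ hF
    exact_mod_cast Finset.card_pos.2 ⟨a, ha⟩
  by_contra! hneg
  linarith [mul_nonpos_of_nonneg_of_nonpos (a := ((1 : ℝ) + 1) ^ d) (by positivity) hneg]

/-! ### The degree bound -/

open Classical in
theorem IsSMT.degree_le {V : Finset (Fin d → ℝ)} {T : SteinerTree V} (hT : K.IsSMT T)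
    (x : T.verts) {μ : ℝ} (hμ : 1 < μ) :
    (T.graph.degree x : ℝ) ≤
      (μ + 1) / (μ - 1) * (μ + 1) ^ d * coveringDensity K.carrier := by
  have hμ1 : 0 < μ - 1 := sub_pos.2 hμ
  rw [← div_le_iff₀' (by positivity)]
  refine le_of_forall_gt_imp_ge_of_dense fun c hc => ?_
  obtain ⟨F, hcard, hF, hcov⟩ :=
    K.exists_finset_cover_of_coveringDensity_lt (zero_lt_one.trans hμ) hc
  have h := hT.degree_mul_le K x (zero_lt_one.trans hμ) F hF hcov
  rw [div_le_iff₀' (by positivity), div_mul_eq_mul_div, div_mul_eq_mul_div, le_div_iff₀ hμ1]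
  refine h.trans ?_
  rw [mul_assoc, mul_comm]
  exact mul_le_mul_of_nonneg_left hcard (by positivity)

/-- The numerical estimate behind the choice `μ = 1 + 1 / (d + 1)`. -/
theorem dilation_factor_lt (d : ℕ) :
    (2 * (d : ℝ) + 3) * (2 + 1 / ((d : ℝ) + 1)) ^ d < 2 ^ (d + 1) * Real.exp 1 * ((d : ℝ) + 1) := by
  set a : ℝ := Real.exp (1 / 2) with ha
  have ha1 : 3 / 2 < a := by
    have := Real.add_one_lt_exp (x := 1 / 2) (by norm_num)
    linarith
  have haa : a * a = Real.exp 1 := by rw [ha, ← Real.exp_add]; norm_num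
  have hpow : (2 + 1 / ((d : ℝ) + 1)) ^ d ≤ 2 ^ d * a := by
    have h1 : 2 + 1 / ((d : ℝ) + 1) = 2 * (1 / (2 * ((d : ℝ) + 1)) + 1) := by
      field_simp
      ring
    rw [h1, mul_pow]
    refine mul_le_mul_of_nonneg_left ?_ (by positivity)
    refine (pow_le_pow_left₀ (by positivity) (Real.add_one_le_exp _) d).trans ?_
    rw [← Real.exp_nat_mul, ha]
    refine Real.exp_le_exp.2 ?_
    rw [mul_one_div, div_le_div_iff₀ (by positivity) (by positivity)]
    linarith
  have hd : (0 : ℝ) ≤ d := Nat.cast_nonneg d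
  calc (2 * (d : ℝ) + 3) * (2 + 1 / ((d : ℝ) + 1)) ^ d ≤ (2 * d + 3) * (2 ^ d * a) := by gcongr
    _ < (2 * a * (d + 1)) * (2 ^ d * a) := by
        refine mul_lt_mul_of_pos_right ?_ (by positivity)
        nlinarith
    _ = 2 ^ (d + 1) * Real.exp 1 * ((d : ℝ) + 1) := by rw [← haa]; ring

open Classical in
theorem IsSMT.degree_lt {V : Finset (Fin d → ℝ)} {T : SteinerTree V} (hT : K.IsSMT T)
    (x : T.verts) :
    (T.graph.degree x : ℝ) <
      2 ^ (d + 1) * Real.exp 1 * ((d : ℝ) + 1) * coveringDensity K.carrier := by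
  have hd : (0 : ℝ) < (d : ℝ) + 1 := by positivity
  have h := hT.degree_le K x (μ := 1 + 1 / ((d : ℝ) + 1)) (lt_add_of_pos_right _ (by positivity))
  have h1 : 1 + 1 / ((d : ℝ) + 1) + 1 = 2 + 1 / ((d : ℝ) + 1) := by ring
  have h2 : (2 + 1 / ((d : ℝ) + 1)) / (1 + 1 / ((d : ℝ) + 1) - 1) = 2 * (d : ℝ) + 3 := by
    rw [add_sub_cancel_left, div_div_eq_mul_div, div_one]
    field_simp
    ring
  rw [h1, h2] at h
  exact h.trans_lt (mul_lt_mul_of_pos_right (dilation_factor_lt d) K.coveringDensity_pos)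

theorem treeLength_nonneg {V : Finset (Fin d → ℝ)} (T : SteinerTree V) : 0 ≤ K.treeLength T := by
  rw [treeLength_eq_sum_image]
  exact Finset.sum_nonneg fun e _ => K.edgeLength_nonneg e

open Classical in
theorem treeLength_eq_zero {V : Finset (Fin d → ℝ)} {T : SteinerTree V}
    (h : ∀ a b, ¬T.graph.Adj a b) : K.treeLength T = 0 := by
  refine Finset.sum_eq_zero fun e he => ?_
  rw [SimpleGraph.mem_edgeFinset] at he
  induction e with
  | _ a b => exact absurd he (h a b)

/-- The one-point tree is a Steiner minimal tree of the empty set, so `0` is the degree of a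
Steiner point. -/
theorem zero_mem_smtSteinerDegrees : 0 ∈ K.smtSteinerDegrees := by
  classical
  let T : SteinerTree (∅ : Finset (Fin d → ℝ)) :=
    { verts := {0}
      subset_verts := Finset.empty_subset _
      graph := ⊥
      isTree := SimpleGraph.IsTree.of_subsingleton }
  refine ⟨∅, T, ⟨0, Finset.mem_singleton_self 0⟩, fun T' => ?_, by simp, ?_⟩
  · rw [K.treeLength_eq_zero fun a b h => h]
    exact K.treeLength_nonneg T'
  · rw [← SimpleGraph.card_neighborFinset_eq_degree, Finset.card_eq_zero,
      Finset.eq_empty_iff_forall_notMem]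
    intro y hy
    rw [SimpleGraph.mem_neighborFinset] at hy
    exact hy

theorem smtSteinerDegrees_subset : K.smtSteinerDegrees ⊆ K.smtVertexDegrees := by
  rintro n ⟨V, T, x, hT, -, hn⟩
  exact ⟨V, T, x, hT, hn⟩

theorem bddAbove_smtVertexDegrees : BddAbove K.smtVertexDegrees := by
  refine ⟨⌈2 ^ (d + 1) * Real.exp 1 * ((d : ℝ) + 1) * coveringDensity K.carrier⌉₊, ?_⟩
  rintro n ⟨V, T, x, hT, rfl⟩
  exact_mod_cast (hT.degree_lt K x).le.trans (Nat.le_ceil _)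

end CentredConvexBody

theorem mainTheorem4 (d : ℕ) (K : CentredConvexBody d) :
    IsGreatest K.smtSteinerDegrees K.sNumber ∧
    IsGreatest K.smtVertexDegrees K.vNumber ∧
    K.sNumber ≤ K.vNumber ∧
    (K.vNumber : ℝ) < 2 ^ (d + 1) * Real.exp 1 * ((d : ℝ) + 1) * coveringDensity K.carrier := by
  have hbv := K.bddAbove_smtVertexDegrees
  have hbs := hbv.mono K.smtSteinerDegrees_subset
  have hs : IsGreatest K.smtSteinerDegrees K.sNumber :=
    ⟨Nat.sSup_mem ⟨0, K.zero_mem_smtSteinerDegrees⟩ hbs, fun n hn => le_csSup hbs hn⟩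
  have hv : IsGreatest K.smtVertexDegrees K.vNumber :=
    ⟨Nat.sSup_mem ⟨0, K.smtSteinerDegrees_subset K.zero_mem_smtSteinerDegrees⟩ hbv,
      fun n hn => le_csSup hbv hn⟩
  refine ⟨hs, hv, hv.2 (K.smtSteinerDegrees_subset hs.1), ?_⟩
  obtain ⟨V, T, x, hT, hx⟩ := hv.1
  rw [← hx]
  exact hT.degree_lt K x
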